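/- Let $\ell, m, n$ be positive integers, let $\|\cdot\|$ be a norm on $\mathbb{R}^m$, and let $X$ be uniformly distributed in $\{\pm1\}^n$. For $S \subseteq [n]$ put $\chi_S(x) = \prod_{j\in S} x_j$. Every $f : \{\pm 1\}^n \to \mathbb{R}^m$ has a unique expansion $f(x) = \sum_{S \subseteq [n]} \hat f(S)\,\chi_S(x)$ with $\hat f(S) \in \mathbb{R}^m$ (namely $\hat f(S) = \mathbb{E}[\chi_S(X) f(X)]$); let $f_\ell(x) = \sum_{S \subseteq [n],\, |S| = \ell} \hat f(S)\,\chi_S(x)$ be its $\ell$-th homogeneous part. Then for every function $f : \{\pm 1\}^n \to \mathbb{R}^m$, $$\bigl(\mathbb{E}\,\|f_\ell(X)\|^2\bigr)^{1/2} \le \Bigl(4 + \frac{6 \log(m+1)}{\ell}\Bigr)^{\ell} \cdot \bigl(\mathbb{E}\,\|f(X)\|^2\bigr)^{1/2},$$ where $\log$ is the natural logarithm. -/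

import Mathlib

open scoped BigOperators

noncomputable section

/-- The discrete cube `{±1}^n`; the units of `ℤ` are exactly `1` and `-1`. -/
abbrev Cube (n : ℕ) : Type := Fin n → ℤˣ

/-- The character `χ_S(x) = ∏_{j ∈ S} x_j`. -/
def chi {n : ℕ} (S : Finset (Fin n)) (x : Cube n) : ℝ :=
  ∏ j ∈ S, ((x j : ℤ) : ℝ)

/-- The Fourier coefficient `f̂(S) = 𝔼 χ_S(X) f(X) ∈ ℝ^m`. That these are the unique coefficients
of `f` in the characters is `sum_cubeCoeff` and `cubeCoeff_unique`. -/
def cubeCoeff {n m : ℕ} (f : Cube n → (Fin m → ℝ)) (S : Finset (Fin n)) : Fin m → ℝ :=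
  𝔼 x : Cube n, chi S x • f x

/-- The `ℓ`-th homogeneous part `f_ℓ(x) = ∑_{|S| = ℓ} f̂(S) χ_S(x)`. -/
def levelPart {n m : ℕ} (ℓ : ℕ) (f : Cube n → (Fin m → ℝ)) (x : Cube n) : Fin m → ℝ :=
  ∑ S : Finset (Fin n) with S.card = ℓ, chi S x • cubeCoeff f S

/-- `(𝔼 ‖f(X)‖²)^{1/2}` for `X` uniform on the cube and the norm `N` on `ℝ^m`. -/
def l2Norm {n m : ℕ} (N : Seminorm ℝ (Fin m → ℝ)) (f : Cube n → (Fin m → ℝ)) : ℝ :=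
  Real.sqrt (𝔼 x : Cube n, N (f x) ^ 2)

theorem sum_chi_mul_chi {n : ℕ} (x y : Cube n) :
    ∑ S : Finset (Fin n), chi S x * chi S y = if x = y then (2 : ℝ) ^ n else 0 := by
  have h : ∑ S : Finset (Fin n), chi S x * chi S y
      = ∏ j : Fin n, (1 + ((x j : ℤ) : ℝ) * ((y j : ℤ) : ℝ)) := by
    rw [Finset.prod_one_add, Finset.powerset_univ]
    exact Finset.sum_congr rfl fun S _ => by simp [chi, Finset.prod_mul_distrib]
  rw [h]
  split_ifs with hxy
  · subst hxy
    have : ∀ j, (1 + ((x j : ℤ) : ℝ) * ((x j : ℤ) : ℝ)) = 2 := fun j => by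
      rcases Int.units_eq_one_or (x j) with h | h <;> simp [h] <;> norm_num
    simp [this]
  · obtain ⟨j, hj⟩ := Function.ne_iff.mp hxy
    refine Finset.prod_eq_zero (Finset.mem_univ j) ?_
    rcases Int.units_eq_one_or (x j) with h | h <;>
      rcases Int.units_eq_one_or (y j) with h' | h' <;> simp_all

/-- The Fourier expansion `f(x) = ∑_S f̂(S) χ_S(x)`. -/
theorem sum_cubeCoeff {n m : ℕ} (f : Cube n → (Fin m → ℝ)) (x : Cube n) :
    ∑ S : Finset (Fin n), chi S x • cubeCoeff f S = f x := by
  ext i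
  simp only [cubeCoeff, Finset.sum_apply, Pi.smul_apply, smul_eq_mul, Finset.expect_apply,
    Fintype.expect_eq_sum_div_card, ← mul_div_assoc, Finset.mul_sum]
  rw [← Finset.sum_div, Finset.sum_comm]
  have : ∀ y : Cube n, ∑ S : Finset (Fin n), chi S x * (chi S y * f y i)
      = if x = y then (2 : ℝ) ^ n * f y i else 0 := fun y => by
    simp_rw [← mul_assoc, ← Finset.sum_mul, sum_chi_mul_chi]
    split_ifs <;> simp
  simp [this]

theorem expect_chi_mul_chi {n : ℕ} (S T : Finset (Fin n)) :
    𝔼 x : Cube n, chi S x * chi T x = if S = T then (1 : ℝ) else 0 := by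
  split_ifs with h
  · subst h
    have : ∀ x : Cube n, chi S x * chi S x = 1 := fun x => by
      rw [chi, ← Finset.prod_mul_distrib]
      refine Finset.prod_eq_one fun j _ => ?_
      rcases Int.units_eq_one_or (x j) with h | h <;> simp [h]
    simp [this]
  · obtain ⟨j, hj⟩ : ∃ j, ¬ (j ∈ S ↔ j ∈ T) := by
      by_contra hc
      push Not at hc
      exact h (Finset.ext hc)
    have e : ∀ x : Cube n, chi S x * chi T x
        = ∏ i, ((if i ∈ S then ((x i : ℤ) : ℝ) else 1) * (if i ∈ T then ((x i : ℤ) : ℝ) else 1)) :=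
      fun x => by rw [Finset.prod_mul_distrib]; simp [chi]
    rw [Fintype.expect_eq_sum_div_card]
    simp_rw [e]
    rw [← Fintype.prod_sum (fun i (u : ℤˣ) =>
      (if i ∈ S then ((u : ℤ) : ℝ) else 1) * (if i ∈ T then ((u : ℤ) : ℝ) else 1))]
    rw [Finset.prod_eq_zero (Finset.mem_univ j), zero_div]
    have hu : (Finset.univ : Finset ℤˣ) = {1, -1} := by decide
    rw [hu, Finset.sum_pair (by decide)]
    by_cases hS : j ∈ S <;> by_cases hT : j ∈ T <;> simp_all

/-- Uniqueness of the Fourier expansion. -/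
theorem cubeCoeff_unique {n m : ℕ} (f : Cube n → (Fin m → ℝ))
    (c : Finset (Fin n) → (Fin m → ℝ))
    (h : ∀ x, f x = ∑ S : Finset (Fin n), chi S x • c S) : c = cubeCoeff f := by
  ext T i
  have : ∀ x : Cube n, chi T x * f x i
      = ∑ S : Finset (Fin n), (chi T x * chi S x) * c S i := fun x => by
    rw [h x]
    simp [Finset.mul_sum, mul_assoc]
  simp only [cubeCoeff, Finset.expect_apply, Pi.smul_apply, smul_eq_mul, this]
  rw [Finset.expect_sum_comm]
  simp_rw [← Finset.expect_mul, expect_chi_mul_chi]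
  simp

end

/-!
Fix `f`. A norming functional `φ` of the `L²` seminorm at `f_ℓ` turns the claim into a bound for the
coefficient of `z ^ ℓ` in the scalar polynomial `p(z) = ∑ k, φ(f_k) z ^ k`, and there are two bounds
on `p`, with `C = (𝔼 ‖f(X)‖²)^{1/2}`:
* `|p| ≤ C` on `[-1, 1]`, where `∑ k, x ^ k f_k` is the noise operator, an average of translates;
* `|p| ≤ ∑ k, |φ(f_k)| ≤ m C` on the unit disc: an Auerbach basis reduces multipliers of
  `ℝ^m`-valued functions to scalar ones, which are contractions by Parseval.

The substitution `z = sin w / cosh 1` and the three lines theorem interpolate between the two to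
give `|p| ≤ (m + 1) ^ y C` for `|z| ≤ y / cosh 1`, `y ≤ 1`. Cauchy's estimate with
`y = ℓ / log (m + 1)`, or on the unit circle when this exceeds `1`, bounds the coefficient.
-/

section TwoConstants

open Complex Metric

theorem sq_norm_sin (w : ℂ) : ‖sin w‖ ^ 2 = Real.sin w.re ^ 2 + Real.sinh w.im ^ 2 := by
  rw [sin_eq, ← ofReal_sin, ← ofReal_cos, ← ofReal_sinh, ← ofReal_cosh, ← ofReal_mul, ← ofReal_mul,
    Complex.sq_norm, normSq_add_mul_I, mul_pow, mul_pow, Real.cosh_sq w.im, Real.cos_sq' w.re]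
  ring

theorem norm_sin_le_cosh_im (w : ℂ) : ‖sin w‖ ≤ Real.cosh w.im := by
  refine le_of_sq_le_sq ?_ (Real.cosh_pos _).le
  rw [sq_norm_sin, Real.cosh_sq]
  linarith [Real.sin_sq_le_one w.re]

theorem abs_im_le_norm_sin (w : ℂ) : |w.im| ≤ ‖sin w‖ := by
  refine le_of_sq_le_sq ?_ (norm_nonneg _)
  have h : |w.im| ^ 2 ≤ Real.sinh w.im ^ 2 := by
    rw [← sq_abs (Real.sinh w.im), Real.abs_sinh]
    exact pow_le_pow_left₀ (abs_nonneg _) (Real.self_le_sinh_iff.2 (abs_nonneg _)) 2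
  rw [sq_norm_sin]
  linarith [sq_nonneg (Real.sin w.re)]

theorem exists_sin_eq_im_nonneg (z : ℂ) : ∃ w, sin w = z ∧ 0 ≤ w.im := by
  obtain ⟨w, rfl⟩ := sin_surjective z
  rcases le_total 0 w.im with h | h
  · exact ⟨w, rfl, h⟩
  · exact ⟨Real.pi - w, sin_pi_sub w, by simpa using h⟩

theorem norm_sin_div_cosh_one (w : ℂ) : ‖sin w / Real.cosh 1‖ = ‖sin w‖ / Real.cosh 1 := by
  rw [norm_div, norm_real, Real.norm_of_nonneg (Real.cosh_pos 1).le]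

theorem norm_sin_div_cosh_one_le_one {w : ℂ} (hw : |w.im| ≤ 1) : ‖sin w / Real.cosh 1‖ ≤ 1 := by
  rw [norm_sin_div_cosh_one, div_le_one (Real.cosh_pos 1)]
  exact (norm_sin_le_cosh_im w).trans (Real.cosh_le_cosh.2 (by rwa [abs_one]))

theorem norm_sin_div_cosh_one_lt_one {w : ℂ} (hw : |w.im| < 1) : ‖sin w / Real.cosh 1‖ < 1 := by
  rw [norm_sin_div_cosh_one, div_lt_one (Real.cosh_pos 1)]
  exact (norm_sin_le_cosh_im w).trans_lt (Real.cosh_lt_cosh.2 (by rwa [abs_one]))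

theorem abs_sin_div_cosh_one_le_one (x : ℝ) : |Real.sin x / Real.cosh 1| ≤ 1 := by
  rw [abs_div, abs_of_pos (Real.cosh_pos 1), div_le_one (Real.cosh_pos 1)]
  exact (Real.abs_sin_le_one x).trans (Real.one_le_cosh 1)

variable {F : Type*} [NormedAddCommGroup F] [NormedSpace ℂ F] {f : ℂ → F} {C D : ℝ}

/- `w ↦ sin w / cosh 1` maps the strip `0 ≤ im w ≤ 1` into the unit disc and its lower edge into
`[-1, 1]`, so this is Hadamard's three lines theorem; Mathlib's strip is vertical, hence `z * I`. -/
theorem norm_comp_sin_div_cosh_le (hf : DiffContOnCl ℂ f (ball 0 1))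
    (hreal : ∀ x : ℝ, |x| ≤ 1 → ‖f x‖ ≤ C) (hdisc : ∀ z, ‖z‖ ≤ 1 → ‖f z‖ ≤ D * C)
    (hD : 0 ≤ D) {w : ℂ} (h0 : 0 ≤ w.im) (h1 : w.im ≤ 1) :
    ‖f (sin w / Real.cosh 1)‖ ≤ D ^ w.im * C := by
  have hC : 0 ≤ C := (norm_nonneg _).trans (hreal 0 (by simp))
  set g : ℂ → ℂ := fun z => sin (z * I) / Real.cosh 1 with hg
  have hclosedBall : ∀ z : ℂ, |z.re| ≤ 1 → ‖g z‖ ≤ 1 := fun z hz =>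
    norm_sin_div_cosh_one_le_one (by simpa using hz)
  have hdiff : DiffContOnCl ℂ (f ∘ g) (HadamardThreeLines.verticalStrip 0 1) := by
    have hgdiff : Differentiable ℂ g := by fun_prop
    refine hf.comp hgdiff.diffContOnCl fun z hz => mem_ball_zero_iff.2 ?_
    exact norm_sin_div_cosh_one_lt_one (by simpa [abs_of_pos hz.1] using hz.2)
  have hbdd : BddAbove ((norm ∘ f ∘ g) '' HadamardThreeLines.verticalClosedStrip 0 1) :=
    ⟨D * C, Set.forall_mem_image.2 fun z hz =>
      hdisc _ (hclosedBall z (by simpa [abs_of_nonneg hz.1] using hz.2))⟩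
  have hleft : ∀ z ∈ re ⁻¹' {0}, ‖(f ∘ g) z‖ ≤ C := fun z (hz : z.re = 0) => by
    have hzI : z * I = ((-z.im : ℝ) : ℂ) := Complex.ext (by simp) (by simpa using hz)
    have hgz : g z = ((Real.sin (-z.im) / Real.cosh 1 : ℝ) : ℂ) := by
      simp only [hg, hzI, ofReal_div, ofReal_sin]
    rw [Function.comp_apply, hgz]
    exact hreal _ (abs_sin_div_cosh_one_le_one _)
  have hright : ∀ z ∈ re ⁻¹' {1}, ‖(f ∘ g) z‖ ≤ D * C := fun z (hz : z.re = 1) =>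
    hdisc _ (hclosedBall z (by simp [hz]))
  have hw : -w * I ∈ HadamardThreeLines.verticalClosedStrip 0 1 := by
    simpa [HadamardThreeLines.verticalClosedStrip] using And.intro h0 h1
  have h := HadamardThreeLines.norm_le_interp_of_mem_verticalClosedStrip₀₁' (f ∘ g) hw hdiff hbdd
    hleft hright
  have hre : (-w * I).re = w.im := by simp
  have hgw : g (-w * I) = sin w / Real.cosh 1 := by simp [hg, mul_assoc]
  rw [Function.comp_apply, hgw, hre, Real.mul_rpow hD hC] at h
  calc ‖f (sin w / Real.cosh 1)‖ ≤ C ^ (1 - w.im) * (D ^ w.im * C ^ w.im) := h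
    _ = D ^ w.im * (C ^ (1 - w.im) * C ^ w.im) := by ring
    _ = D ^ w.im * C := by
        rw [← Real.rpow_add_of_nonneg hC (by linarith) h0, sub_add_cancel, Real.rpow_one]

theorem norm_le_rpow_mul_of_norm_le_div_cosh (hf : DiffContOnCl ℂ f (ball 0 1))
    (hreal : ∀ x : ℝ, |x| ≤ 1 → ‖f x‖ ≤ C) (hdisc : ∀ z, ‖z‖ ≤ 1 → ‖f z‖ ≤ D * C)
    (hD : 1 ≤ D) {y : ℝ} (hy : y ≤ 1) {z : ℂ} (hz : ‖z‖ ≤ y / Real.cosh 1) :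
    ‖f z‖ ≤ D ^ y * C := by
  have hC : 0 ≤ C := (norm_nonneg _).trans (hreal 0 (by simp))
  have hcosh := Real.cosh_pos 1
  obtain ⟨w, hw, hw0⟩ := exists_sin_eq_im_nonneg (z * Real.cosh 1)
  have hwy : w.im ≤ y := by
    calc w.im ≤ ‖sin w‖ := (le_abs_self _).trans (abs_im_le_norm_sin w)
      _ = ‖z‖ * Real.cosh 1 := by rw [hw, norm_mul, norm_real, Real.norm_of_nonneg hcosh.le]
      _ ≤ y := (le_div_iff₀ hcosh).1 hz
  have hzw : z = sin w / Real.cosh 1 := by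
    rw [hw, mul_div_cancel_right₀ _ (ofReal_ne_zero.2 hcosh.ne')]
  rw [hzw]
  refine (norm_comp_sin_div_cosh_le hf hreal hdisc (by linarith) hw0 (hwy.trans hy)).trans ?_
  gcongr

theorem exp_one_mul_cosh_one_le : Real.exp 1 * Real.cosh 1 ≤ 6 := by
  have hexp := Real.exp_one_lt_three
  have h : Real.exp 1 * Real.exp (-1) = 1 := by rw [← Real.exp_add]; simp
  rw [Real.cosh_eq]
  nlinarith [Real.exp_pos 1]

theorem norm_iteratedDeriv_zero_le_of_le_log [CompleteSpace F] (hf : DiffContOnCl ℂ f (ball 0 1))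
    (hreal : ∀ x : ℝ, |x| ≤ 1 → ‖f x‖ ≤ C) (hdisc : ∀ z, ‖z‖ ≤ 1 → ‖f z‖ ≤ D * C)
    (hD : 1 ≤ D) {ℓ : ℕ} (hℓ : 0 < ℓ) (hlog : ℓ ≤ Real.log D) :
    ‖iteratedDeriv ℓ f 0‖ ≤ ℓ.factorial * ((6 * Real.log D / ℓ) ^ ℓ * C) := by
  have hC : 0 ≤ C := (norm_nonneg _).trans (hreal 0 (by simp))
  have hcosh := Real.cosh_pos 1
  have hlog_pos : 0 < Real.log D := (Nat.cast_pos.2 hℓ).trans_le hlog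
  -- With this radius the interpolated bound `D ^ y` costs only a constant factor per degree.
  set y : ℝ := ℓ / Real.log D with hy
  have hy1 : y ≤ 1 := (div_le_one hlog_pos).2 hlog
  have hDy : D ^ y = Real.exp 1 ^ ℓ := by
    rw [Real.rpow_def_of_pos (by linarith), hy, mul_div_cancel₀ _ hlog_pos.ne', Real.exp_one_pow]
  have hradius : y / Real.cosh 1 ≤ 1 := (div_le_one hcosh).2 (hy1.trans (Real.one_le_cosh 1))
  have hcauchy : ‖iteratedDeriv ℓ f 0‖
      ≤ ℓ.factorial * (D ^ y * C) / (y / Real.cosh 1) ^ ℓ :=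
    norm_iteratedDeriv_le_of_forall_mem_sphere_norm_le ℓ (by positivity)
      (hf.mono (ball_subset_ball hradius)) fun z hz =>
        norm_le_rpow_mul_of_norm_le_div_cosh hf hreal hdisc hD hy1
          (mem_sphere_zero_iff_norm.1 hz).le
  refine hcauchy.trans ?_
  rw [mul_div_assoc, mul_div_right_comm, hDy, ← div_pow]
  gcongr ℓ.factorial * (?_ ^ ℓ * C)
  calc Real.exp 1 / (y / Real.cosh 1) = Real.exp 1 * Real.cosh 1 * Real.log D / ℓ := by
        rw [hy]; field_simp
    _ ≤ 6 * Real.log D / ℓ := by gcongr; exact exp_one_mul_cosh_one_le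

theorem norm_iteratedDeriv_zero_le [CompleteSpace F] (hf : DiffContOnCl ℂ f (ball 0 1))
    (hreal : ∀ x : ℝ, |x| ≤ 1 → ‖f x‖ ≤ C) (hdisc : ∀ z, ‖z‖ ≤ 1 → ‖f z‖ ≤ D * C)
    (hD : 1 ≤ D) {ℓ : ℕ} (hℓ : 0 < ℓ) :
    ‖iteratedDeriv ℓ f 0‖ ≤ ℓ.factorial * ((4 + 6 * Real.log D / ℓ) ^ ℓ * C) := by
  have hC : 0 ≤ C := (norm_nonneg _).trans (hreal 0 (by simp))
  have hlog : 0 ≤ 6 * Real.log D / ℓ :=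
    div_nonneg (mul_nonneg (by norm_num) (Real.log_nonneg hD)) ℓ.cast_nonneg
  rcases le_total (Real.log D) ℓ with hlt | hge
  · have hcauchy : ‖iteratedDeriv ℓ f 0‖ ≤ ℓ.factorial * (D * C) := by
      simpa using norm_iteratedDeriv_le_of_forall_mem_sphere_norm_le ℓ one_pos hf
        fun z hz => hdisc z (mem_sphere_zero_iff_norm.1 hz).le
    refine hcauchy.trans ?_
    gcongr
    calc D ≤ Real.exp ℓ := (Real.log_le_iff_le_exp (by linarith)).1 hlt
      _ = Real.exp 1 ^ ℓ := (Real.exp_one_pow ℓ).symm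
      _ ≤ (4 + 6 * Real.log D / ℓ) ^ ℓ := by
        gcongr
        linarith [Real.exp_one_lt_three]
  · refine (norm_iteratedDeriv_zero_le_of_le_log hf hreal hdisc hD hℓ hge).trans ?_
    gcongr
    linarith

end TwoConstants

theorem iteratedDeriv_eval_zero {𝕜 : Type*} [NontriviallyNormedField 𝕜] (p : Polynomial 𝕜) (k : ℕ) :
    iteratedDeriv k (fun z => p.eval z) 0 = k.factorial * p.coeff k := by
  have h : iteratedDeriv k (fun z => p.eval z) = fun z => (Polynomial.derivative^[k] p).eval z := by
    induction k with
    | zero => simp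
    | succ k ih =>
      ext z
      rw [iteratedDeriv_succ, ih, Function.iterate_succ_apply', Polynomial.deriv]
  rw [congrFun h 0, ← Polynomial.coeff_zero_eq_eval_zero, Polynomial.coeff_iterate_derivative]
  simp [Nat.descFactorial_self]

theorem exists_dual_apply_eq_seminorm {E : Type*} [AddCommGroup E] [Module ℝ E]
    (P : Seminorm ℝ E) (v : E) : ∃ φ : Module.Dual ℝ E, φ v = P v ∧ ∀ u, |φ u| ≤ P u := by
  let : SeminormedAddCommGroup E := P.toSeminormedAddCommGroup
  let : NormedSpace ℝ E := { norm_smul_le := fun c u => (map_smul_eq_mul P c u).le }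
  obtain ⟨g, hg, hgv⟩ := exists_dual_vector'' ℝ v
  exact ⟨g, hgv, fun u => by simpa using! g.le_of_opNorm_le hg u⟩

section Auerbach

open Metric

variable {ι E : Type*} [NormedAddCommGroup E] [NormedSpace ℝ E]

theorem continuous_basis_det [Fintype ι] [DecidableEq ι] (b : Module.Basis ι ℝ E) :
    Continuous fun v : ι → E => b.det v := by
  have : FiniteDimensional ℝ E := b.finiteDimensional_of_finite
  refine Continuous.matrix_det (continuous_matrix fun i j => ?_)
  exact (b.coord i).continuous_of_finiteDimensional.comp (continuous_apply j)

theorem exists_mem_closedBall_forall_abs_det_le [Fintype ι] [DecidableEq ι]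
    (b : Module.Basis ι ℝ E) :
    ∃ v ∈ closedBall (0 : ι → E) 1, b.det v ≠ 0 ∧
      ∀ u ∈ closedBall (0 : ι → E) 1, |b.det u| ≤ |b.det v| := by
  have : FiniteDimensional ℝ E := b.finiteDimensional_of_finite
  have := FiniteDimensional.proper_real E
  obtain ⟨v, hv, hmax⟩ := (isCompact_closedBall (0 : ι → E) 1).exists_isMaxOn
    ⟨0, mem_closedBall_self zero_le_one⟩ (continuous_basis_det b).abs.continuousOn
  refine ⟨v, hv, fun hv0 => ?_, fun u hu => hmax hu⟩
  let u : ι → E := fun i => ‖b i‖⁻¹ • b i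
  have hu : u ∈ closedBall (0 : ι → E) 1 := by
    rw [mem_closedBall_zero_iff, pi_norm_le_iff_of_nonneg zero_le_one]
    intro i
    simp [u, norm_smul, b.ne_zero i]
  have hdet : b.det u = ∏ i, ‖b i‖⁻¹ := by
    rw [b.det.map_smul_univ, b.det_self, smul_eq_mul, mul_one]
  have hu0 : |b.det u| ≤ 0 := by simpa [hv0] using hmax hu
  rw [abs_nonpos_iff, hdet, Finset.prod_eq_zero_iff] at hu0
  obtain ⟨i, -, hi⟩ := hu0
  exact b.ne_zero i (by simpa using hi)

/- Vectors spanning maximal volume in the unit ball work: by Cramer's rule the coordinates of `u`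
are quotients of a determinant by the maximal one. -/
theorem exists_basis_norm_le_one_abs_coord_le [Finite ι] (b₀ : Module.Basis ι ℝ E) :
    ∃ b : Module.Basis ι ℝ E, (∀ i, ‖b i‖ ≤ 1) ∧ ∀ i u, |b.coord i u| ≤ ‖u‖ := by
  classical
  have := Fintype.ofFinite ι
  obtain ⟨v, hv, hdet, hmax⟩ := exists_mem_closedBall_forall_abs_det_le b₀
  have hv_norm : ∀ i, ‖v i‖ ≤ 1 :=
    (pi_norm_le_iff_of_nonneg zero_le_one).1 (mem_closedBall_zero_iff.1 hv)
  obtain ⟨hli, hsp⟩ := b₀.is_basis_iff_det.2 hdet.isUnit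
  refine ⟨.mk hli hsp.ge, by simpa using hv_norm, fun i u => ?_⟩
  have hunit : ∀ u : E, ‖u‖ ≤ 1 → |(Module.Basis.mk hli hsp.ge).coord i u| ≤ 1 := fun u hu => by
    have hupd : Function.update v i u ∈ closedBall (0 : ι → E) 1 := by
      rw [mem_closedBall_zero_iff, pi_norm_le_iff_of_nonneg zero_le_one]
      exact (Function.forall_update_iff v fun _ w => ‖w‖ ≤ 1).2 ⟨hu, fun j _ => hv_norm j⟩
    have hcramer : b₀.det v * (Module.Basis.mk hli hsp.ge).coord i u
        = b₀.det (Function.update v i u) :=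
      LinearMap.congr_fun (b₀.det_smul_mk_coord_eq_det_update hli hsp.ge i) u
    have h := hmax _ hupd
    rwa [← hcramer, abs_mul, mul_le_iff_le_one_right (abs_pos.2 hdet)] at h
  have := b₀.finiteDimensional_of_finite
  have hop : ‖((Module.Basis.mk hli hsp.ge).coord i).toContinuousLinearMap‖ ≤ 1 :=
    ContinuousLinearMap.opNorm_le_of_unit_norm zero_le_one fun u hu => hunit u hu.le
  simpa using! ContinuousLinearMap.le_of_opNorm_le _ hop u

end Auerbach

theorem exists_dual_abs_le_and_le_sum_abs {E : Type*} [AddCommGroup E] [Module ℝ E]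
    [FiniteDimensional ℝ E] (N : Seminorm ℝ E) :
    ∃ d ≤ Module.finrank ℝ E, ∃ φ : Fin d → Module.Dual ℝ E,
      (∀ i u, |φ i u| ≤ N u) ∧ ∀ u, N u ≤ ∑ i, |φ i u| := by
  let : SeminormedAddCommGroup E := N.toSeminormedAddCommGroup
  let : NormedSpace ℝ E := { norm_smul_le := fun c u => (map_smul_eq_mul N c u).le }
  let π : E →ₗ[ℝ] SeparationQuotient E := SeparationQuotient.mkCLM ℝ E
  obtain ⟨b, hb, hcoord⟩ :=
    exists_basis_norm_le_one_abs_coord_le (Module.finBasis ℝ (SeparationQuotient E))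
  refine ⟨_, LinearMap.finrank_le_finrank_of_surjective (f := π) SeparationQuotient.surjective_mk,
    fun i => b.coord i ∘ₗ π, fun i u => hcoord i (π u), fun u => ?_⟩
  calc N u = ‖π u‖ := rfl
    _ = ‖∑ i, b.coord i (π u) • b i‖ := congrArg _ (b.sum_repr (π u)).symm
    _ ≤ ∑ i, ‖b.coord i (π u) • b i‖ := norm_sum_le _ _
    _ ≤ ∑ i, |b.coord i (π u)| := by
      gcongr with i
      rw [norm_smul]
      exact mul_le_of_le_one_right (norm_nonneg _) (hb i)

section L2Norm

variable {n m : ℕ}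

theorem l2Norm_nonneg (N : Seminorm ℝ (Fin m → ℝ)) (f : Cube n → (Fin m → ℝ)) : 0 ≤ l2Norm N f :=
  Real.sqrt_nonneg _

theorem sq_l2Norm (N : Seminorm ℝ (Fin m → ℝ)) (f : Cube n → (Fin m → ℝ)) :
    l2Norm N f ^ 2 = 𝔼 x : Cube n, N (f x) ^ 2 :=
  Real.sq_sqrt (Finset.expect_nonneg fun _ _ => sq_nonneg _)

theorem l2Norm_add_le (N : Seminorm ℝ (Fin m → ℝ)) (f g : Cube n → (Fin m → ℝ)) :
    l2Norm N (f + g) ≤ l2Norm N f + l2Norm N g := by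
  have hf := l2Norm_nonneg N f
  have hg := l2Norm_nonneg N g
  refine le_of_sq_le_sq ?_ (add_nonneg hf hg)
  have hcs : 𝔼 x : Cube n, N (f x) * N (g x) ≤ l2Norm N f * l2Norm N g := by
    refine le_of_sq_le_sq ?_ (mul_nonneg hf hg)
    rw [mul_pow, sq_l2Norm, sq_l2Norm]
    exact Finset.expect_mul_sq_le_sq_mul_sq _ _ _
  calc l2Norm N (f + g) ^ 2 = 𝔼 x : Cube n, N (f x + g x) ^ 2 := sq_l2Norm N _
    _ ≤ 𝔼 x : Cube n, (N (f x) + N (g x)) ^ 2 := by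
      gcongr with x
      exact map_add_le_add N _ _
    _ = l2Norm N f ^ 2 + 2 * (𝔼 x : Cube n, N (f x) * N (g x)) + l2Norm N g ^ 2 := by
      simp only [add_sq, mul_assoc, Finset.expect_add_distrib, ← Finset.mul_expect, sq_l2Norm]
    _ ≤ (l2Norm N f + l2Norm N g) ^ 2 := by linarith

theorem l2Norm_smul (N : Seminorm ℝ (Fin m → ℝ)) (c : ℝ) (f : Cube n → (Fin m → ℝ)) :
    l2Norm N (c • f) = |c| * l2Norm N f := by
  simp only [l2Norm, Pi.smul_apply, map_smul_eq_mul, mul_pow, Real.norm_eq_abs, sq_abs,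
    ← Finset.mul_expect]
  rw [Real.sqrt_mul (sq_nonneg c), Real.sqrt_sq_eq_abs]

variable (n) in
/-- The seminorm `f ↦ (𝔼 N(f(X))²)^{1/2}` on functions on the cube; bundling `l2Norm` gives access
to norming functionals. -/
noncomputable def l2Seminorm (N : Seminorm ℝ (Fin m → ℝ)) : Seminorm ℝ (Cube n → (Fin m → ℝ)) :=
  .of (l2Norm N) (l2Norm_add_le N) (l2Norm_smul N)

theorem l2Norm_comp_mul_right (N : Seminorm ℝ (Fin m → ℝ)) (f : Cube n → (Fin m → ℝ))
    (y : Cube n) : l2Norm N (fun x => f (x * y)) = l2Norm N f :=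
  congrArg Real.sqrt (Fintype.expect_equiv (Equiv.mulRight y) _ _ fun _ => rfl)

theorem seminorm_expect_smul_le {ι E : Type*} [Fintype ι] [AddCommGroup E] [Module ℝ E]
    [Module ℚ≥0 E] (P : Seminorm ℝ E) {K : ι → ℝ} (hK : ∀ i, 0 ≤ K i) (v : ι → E) :
    P (𝔼 i, K i • v i) ≤ 𝔼 i, K i * P (v i) := by
  have hsmul (k : ℕ) (u : E) : P ((k : ℚ≥0)⁻¹ • u) = (k : ℚ≥0)⁻¹ • P u := by
    rw [← NNRat.cast_smul_eq_nnqsmul ℝ, map_smul_eq_mul, ← NNRat.cast_smul_eq_nnqsmul ℝ,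
      smul_eq_mul, Real.norm_of_nonneg (NNRat.cast_nonneg _)]
  calc P (𝔼 i, K i • v i) ≤ 𝔼 i, P (K i • v i) :=
        Finset.le_expect_of_subadditive (map_zero P) (map_add_le_add P) hsmul
    _ = 𝔼 i, K i * P (v i) := by
        simp only [map_smul_eq_mul, Real.norm_eq_abs, abs_of_nonneg (hK _)]

end L2Norm

section LevelMultiplier

variable {n m : ℕ}

/-- The Fourier multiplier acting on the `k`-th level of the expansion as multiplication by `s k`;
for `s k = ρ ^ k` it is the noise operator with parameter `ρ`. -/
noncomputable def levelMultiplier (s : ℕ → ℝ) (f : Cube n → (Fin m → ℝ)) (x : Cube n) : Fin m → ℝ :=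
  ∑ S : Finset (Fin n), (s S.card * chi S x) • cubeCoeff f S

theorem sum_smul_levelPart {d : ℕ} (hd : n < d) (s : ℕ → ℝ) (f : Cube n → (Fin m → ℝ)) :
    ∑ k ∈ Finset.range d, s k • levelPart k f = levelMultiplier s f := by
  ext1 x
  simp only [Finset.sum_apply, Pi.smul_apply, levelPart, levelMultiplier, Finset.smul_sum,
    smul_smul]
  have hcard : ∀ S ∈ (Finset.univ : Finset (Finset (Fin n))), S.card ∈ Finset.range d :=
    fun S _ => Finset.mem_range.2 ((card_finset_fin_le S).trans_lt hd)
  rw [← Finset.sum_fiberwise_of_maps_to hcard]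
  refine Finset.sum_congr rfl fun k _ => Finset.sum_congr rfl fun S hS => ?_
  rw [(Finset.mem_filter.1 hS).2]

theorem expect_sq_sum_chi (c : Finset (Fin n) → ℝ) :
    𝔼 x : Cube n, (∑ S, chi S x * c S) ^ 2 = ∑ S, c S ^ 2 := by
  have hsq (x : Cube n) : (∑ S, chi S x * c S) ^ 2
      = ∑ S, ∑ T, (chi S x * chi T x) * (c S * c T) := by
    simp only [sq, Finset.sum_mul_sum, mul_mul_mul_comm]
  simp only [hsq, Finset.expect_sum_comm, ← Finset.expect_mul, expect_chi_mul_chi]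
  simp [sq]

theorem expect_sq_levelMultiplier_le {s : ℕ → ℝ} (hs : ∀ k, |s k| ≤ 1)
    (φ : Module.Dual ℝ (Fin m → ℝ)) (f : Cube n → (Fin m → ℝ)) :
    𝔼 x : Cube n, φ (levelMultiplier s f x) ^ 2 ≤ 𝔼 x : Cube n, φ (f x) ^ 2 := by
  have hmul (x : Cube n) :
      φ (levelMultiplier s f x) = ∑ S, chi S x * (s S.card * φ (cubeCoeff f S)) := by
    simp only [levelMultiplier, map_sum, map_smul, smul_eq_mul, mul_left_comm, mul_assoc]
  have hf (x : Cube n) : φ (f x) = ∑ S, chi S x * φ (cubeCoeff f S) := by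
    conv_lhs => rw [← sum_cubeCoeff f x]
    simp only [map_sum, map_smul, smul_eq_mul]
  simp only [hmul, hf, expect_sq_sum_chi, mul_pow]
  gcongr with S
  exact mul_le_of_le_one_left (sq_nonneg _) ((sq_le_one_iff_abs_le_one _).2 (hs _))

theorem l2Norm_levelMultiplier_le (N : Seminorm ℝ (Fin m → ℝ)) {s : ℕ → ℝ} (hs : ∀ k, |s k| ≤ 1)
    (f : Cube n → (Fin m → ℝ)) : l2Norm N (levelMultiplier s f) ≤ m * l2Norm N f := by
  obtain ⟨d, hd, φ, hφN, hNφ⟩ := exists_dual_abs_le_and_le_sum_abs N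
  rw [Module.finrank_fin_fun] at hd
  refine le_of_sq_le_sq ?_ (mul_nonneg m.cast_nonneg (l2Norm_nonneg N f))
  rw [mul_pow, sq_l2Norm, sq_l2Norm]
  calc 𝔼 x, N (levelMultiplier s f x) ^ 2
      ≤ 𝔼 x, d * ∑ i, φ i (levelMultiplier s f x) ^ 2 := by
        gcongr with x
        calc N (levelMultiplier s f x) ^ 2
            ≤ (∑ i, |φ i (levelMultiplier s f x)|) ^ 2 := by gcongr; exact hNφ _
          _ ≤ d * ∑ i, φ i (levelMultiplier s f x) ^ 2 := by
            simpa using sq_sum_le_card_mul_sum_sq (s := Finset.univ)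
              (f := fun i => |φ i (levelMultiplier s f x)|)
    _ = d * ∑ i, 𝔼 x, φ i (levelMultiplier s f x) ^ 2 := by
        rw [← Finset.mul_expect, Finset.expect_sum_comm]
    _ ≤ d * ∑ _i : Fin d, 𝔼 x, N (f x) ^ 2 := by
        gcongr d * ∑ i, ?_ with i
        refine (expect_sq_levelMultiplier_le hs (φ i) f).trans ?_
        refine Finset.expect_le_expect fun x _ => ?_
        exact sq_le_sq' (abs_le.1 (hφN i _)).1 (abs_le.1 (hφN i _)).2
    _ = d ^ 2 * 𝔼 x, N (f x) ^ 2 := by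
        rw [Finset.sum_const, Finset.card_univ, Fintype.card_fin, nsmul_eq_mul, sq, mul_assoc]
    _ ≤ m ^ 2 * 𝔼 x, N (f x) ^ 2 := by gcongr

end LevelMultiplier

section Noise

variable {n m : ℕ} {ρ : ℝ}

/-- The Riesz product `∏ j, (1 + ρ y_j)`: the density, with respect to the uniform measure, of the
noise whose convolution is the noise operator with parameter `ρ`. -/
noncomputable def rieszProduct (ρ : ℝ) (y : Cube n) : ℝ :=
  ∏ j, (1 + ρ * ((y j : ℤ) : ℝ))

theorem chi_mul (S : Finset (Fin n)) (x y : Cube n) : chi S (x * y) = chi S x * chi S y := by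
  simp [chi, Finset.prod_mul_distrib]

theorem rieszProduct_eq_sum (ρ : ℝ) (y : Cube n) :
    rieszProduct ρ y = ∑ S : Finset (Fin n), ρ ^ S.card * chi S y := by
  simp only [rieszProduct, Finset.prod_one_add, Finset.powerset_univ, chi,
    Finset.prod_mul_distrib, Finset.prod_const]

theorem rieszProduct_nonneg (hρ : |ρ| ≤ 1) (y : Cube n) : 0 ≤ rieszProduct ρ y := by
  refine Finset.prod_nonneg fun j _ => ?_
  have := abs_le.1 hρ
  rcases Int.units_eq_one_or (y j) with h | h <;> rw [h] <;> push_cast <;> linarith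

theorem expect_rieszProduct_mul_chi (ρ : ℝ) (S : Finset (Fin n)) :
    𝔼 y, rieszProduct ρ y * chi S y = ρ ^ S.card := by
  simp only [rieszProduct_eq_sum, Finset.sum_mul, mul_assoc, Finset.expect_sum_comm,
    ← Finset.mul_expect, expect_chi_mul_chi]
  simp

theorem expect_rieszProduct (n : ℕ) (ρ : ℝ) : 𝔼 y : Cube n, rieszProduct ρ y = 1 := by
  simpa [chi] using expect_rieszProduct_mul_chi ρ (∅ : Finset (Fin n))

theorem levelMultiplier_pow_eq_expect (ρ : ℝ) (f : Cube n → (Fin m → ℝ)) :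
    levelMultiplier (fun k => ρ ^ k) f = 𝔼 y, rieszProduct ρ y • fun x => f (x * y) := by
  ext x i
  calc levelMultiplier (fun k => ρ ^ k) f x i
      = ∑ S, (𝔼 y, rieszProduct ρ y * chi S y) * (chi S x * cubeCoeff f S i) := by
        simp only [levelMultiplier, Finset.sum_apply, Pi.smul_apply, smul_eq_mul,
          expect_rieszProduct_mul_chi, mul_assoc]
    _ = 𝔼 y, rieszProduct ρ y * ∑ S, chi S (x * y) * cubeCoeff f S i := by
        simp only [Finset.expect_mul, ← Finset.expect_sum_comm, Finset.mul_sum, chi_mul, mul_assoc,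
          mul_left_comm (chi _ x)]
    _ = (𝔼 y, rieszProduct ρ y • fun x => f (x * y)) x i := by
        simp only [Finset.expect_apply, Pi.smul_apply, smul_eq_mul, ← sum_cubeCoeff f (x * _),
          Finset.sum_apply]

theorem l2Norm_levelMultiplier_pow_le (N : Seminorm ℝ (Fin m → ℝ)) (hρ : |ρ| ≤ 1)
    (f : Cube n → (Fin m → ℝ)) : l2Norm N (levelMultiplier (fun k => ρ ^ k) f) ≤ l2Norm N f := by
  calc l2Norm N (levelMultiplier (fun k => ρ ^ k) f)
      = l2Seminorm n N (𝔼 y, rieszProduct ρ y • fun x => f (x * y)) := by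
        rw [levelMultiplier_pow_eq_expect]; rfl
    _ ≤ 𝔼 y, rieszProduct ρ y * l2Norm N (fun x => f (x * y)) :=
        seminorm_expect_smul_le (l2Seminorm n N) (rieszProduct_nonneg hρ) _
    _ = l2Norm N f := by
        simp only [l2Norm_comp_mul_right, ← Finset.expect_mul, expect_rieszProduct, one_mul]

end Noise

section SeminormCoefficient

variable {E : Type*} [AddCommGroup E] [Module ℝ E] (P : Seminorm ℝ E) {v : ℕ → E} {t : Finset ℕ}
  {C D : ℝ}

theorem sum_abs_dual_le_of_forall_abs_le_one {φ : Module.Dual ℝ E} (hφ : ∀ u, |φ u| ≤ P u)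
    (hC : ∀ s : ℕ → ℝ, (∀ k, |s k| ≤ 1) → P (∑ k ∈ t, s k • v k) ≤ C) :
    ∑ k ∈ t, |φ (v k)| ≤ C := by
  let s : ℕ → ℝ := fun k => SignType.sign (φ (v k))
  have hs (k : ℕ) : |s k| ≤ 1 := by
    rcases hk : SignType.sign (φ (v k)) <;> simp [s, hk]
  calc ∑ k ∈ t, |φ (v k)| = φ (∑ k ∈ t, s k • v k) := by
        simp only [map_sum, map_smul, smul_eq_mul, s, sign_mul_self]
    _ ≤ P (∑ k ∈ t, s k • v k) := (le_abs_self _).trans (hφ _)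
    _ ≤ C := hC s hs

theorem seminorm_coeff_le {ℓ : ℕ} (hℓ : 0 < ℓ) (hℓt : ℓ ∈ t) (hD : 1 ≤ D)
    (hreal : ∀ x : ℝ, |x| ≤ 1 → P (∑ k ∈ t, x ^ k • v k) ≤ C)
    (hsigns : ∀ s : ℕ → ℝ, (∀ k, |s k| ≤ 1) → P (∑ k ∈ t, s k • v k) ≤ D * C) :
    P (v ℓ) ≤ (4 + 6 * Real.log D / ℓ) ^ ℓ * C := by
  obtain ⟨φ, hφℓ, hφ⟩ := exists_dual_apply_eq_seminorm P (v ℓ)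
  let p : Polynomial ℂ := ∑ k ∈ t, Polynomial.monomial k (φ (v k) : ℂ)
  have heval (z : ℂ) : p.eval z = ∑ k ∈ t, φ (v k) * z ^ k := by
    simp only [p, Polynomial.eval_finsetSum, Polynomial.eval_monomial]
  have hcoeff : p.coeff ℓ = P (v ℓ) := by
    simp [p, Polynomial.finsetSum_coeff, Polynomial.coeff_monomial, hℓt, hφℓ]
  have hp_real (x : ℝ) (hx : |x| ≤ 1) : ‖p.eval (x : ℂ)‖ ≤ C := by
    have hφx : p.eval (x : ℂ) = (φ (∑ k ∈ t, x ^ k • v k) : ℝ) := by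
      rw [heval]
      simp [mul_comm]
    rw [hφx, Complex.norm_real]
    exact (hφ _).trans (hreal x hx)
  have hp_disc (z : ℂ) (hz : ‖z‖ ≤ 1) : ‖p.eval z‖ ≤ D * C := by
    calc ‖p.eval z‖ ≤ ∑ k ∈ t, ‖(φ (v k) : ℂ) * z ^ k‖ := heval z ▸ norm_sum_le _ _
      _ ≤ ∑ k ∈ t, |φ (v k)| := by
        gcongr with k
        rw [norm_mul, norm_pow, Complex.norm_real]
        exact mul_le_of_le_one_right (abs_nonneg _) (pow_le_one₀ (norm_nonneg z) hz)
      _ ≤ D * C := sum_abs_dual_le_of_forall_abs_le_one P hφ hsigns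
  have h := norm_iteratedDeriv_zero_le p.differentiable.diffContOnCl hp_real hp_disc hD hℓ
  rw [iteratedDeriv_eval_zero, hcoeff, norm_mul, Complex.norm_natCast, Complex.norm_real,
    Real.norm_of_nonneg (apply_nonneg P _)] at h
  exact le_of_mul_le_mul_left h (by positivity)

end SeminormCoefficient

theorem theorem3_general (ℓ m n : ℕ) (hℓ : 0 < ℓ) (N : Seminorm ℝ (Fin m → ℝ))
    (f : Cube n → (Fin m → ℝ)) :
    l2Norm N (levelPart ℓ f) ≤ (4 + 6 * Real.log ((m : ℝ) + 1) / (ℓ : ℝ)) ^ ℓ * l2Norm N f := by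
  have hrange : n < n + ℓ + 1 := by omega
  refine seminorm_coeff_le (l2Seminorm n N) (v := fun k => levelPart k f)
    (t := Finset.range (n + ℓ + 1)) hℓ (Finset.mem_range.2 (by omega)) (by simp) ?_ ?_
  · intro x hx
    rw [sum_smul_levelPart hrange (fun k => x ^ k)]
    exact l2Norm_levelMultiplier_pow_le N hx f
  · intro s hs
    rw [sum_smul_levelPart hrange]
    calc l2Norm N (levelMultiplier s f) ≤ m * l2Norm N f := l2Norm_levelMultiplier_le N hs f
      _ ≤ (m + 1) * l2Norm N f := by
        gcongr
        · exact l2Norm_nonneg N f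
        · linarith

theorem theorem3 (ℓ m n : ℕ) (hℓ : 0 < ℓ) (hm : 0 < m) (hn : 0 < n)
    (N : Seminorm ℝ (Fin m → ℝ)) (hN : ∀ v : Fin m → ℝ, N v = 0 → v = 0)
    (f : Cube n → (Fin m → ℝ)) :
    l2Norm N (levelPart ℓ f) ≤ (4 + 6 * Real.log ((m : ℝ) + 1) / (ℓ : ℝ)) ^ ℓ * l2Norm N f :=
  theorem3_general ℓ m n hℓ N f
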